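/- For real $\alpha>0$, $\beta>0$ let $E_{\alpha,\beta}(z)=\sum_{k=0}^\infty \frac{z^k}{\Gamma(\alpha k+\beta)}$ $(z\in\mathbb{C})$ be the Mittag-Leffler function, and for $t>0$, $s\in(0,1]$ let $f(\lambda)=E_{\alpha,\beta}(-t^\alpha\lambda^s)$, where $\lambda^s$ is the principal branch on $\mathbb{C}\setminus(-\infty,0]$ and $0^s=0$. Let $\alpha\in(0,1]$. (i) For every $\sigma\in(0,1]$ with $\sigma+\alpha<2$ there is a constant $c>0$, depending only on $\alpha$ and $\sigma$, such that for all $\beta\ge\alpha$, $t>0$ and $s\in(0,\sigma]$ $$|E_{\alpha,\beta}(-t^\alpha\lambda^s)|\le\frac{c}{1+t^\alpha|\lambda|^s}\qquad\text{for all }\lambda\in i\mathbb{R}.\tag{1}$$ (In particular, if $\alpha<1$, then with $\sigma=1$ the constant depends only on $\alpha$.) (ii) Let $\beta\ge\alpha$, $t>0$, $s\in(0,1]$ with $s+\alpha<2$, let $\lambda_{\min}>0$, and let $c_\alpha>0$ be any constant for which (1) holds with $c=c_\alpha$ for these $\alpha,\beta,t,s$. Then the imaginary-axis constant $$c_f:=\int_{i\mathbb{R}}\left|\frac{f(\zeta)}{\zeta+\lambda_{\min}}\right|\,|d\zeta|$$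 is finite and $$c_f\le 2c_\alpha\left(\lambda_{\min}^{-1}+s^{-1}\ln(1+t^{-\alpha})\right).$$ -/

import Mathlib

open MeasureTheory

/-- The two-parameter Mittag-Leffler function `E_{α,β}(z) = ∑_{k ≥ 0} z^k / Γ(α k + β)`. -/
noncomputable def mittagLeffler (α β : ℝ) (z : ℂ) : ℂ :=
  ∑' k : ℕ, z ^ k / ((Real.Gamma (α * k + β) : ℝ) : ℂ)

/-- The function `f(z) = E_{α,β}(-t^α z^s)`, extended to complex `z` by the principal branch
of `z^s` (with `0^s = 0` for `s > 0`). -/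
noncomputable def fracML (α β t s : ℝ) (z : ℂ) : ℂ :=
  mittagLeffler α β (-((t ^ α : ℝ) : ℂ) * z ^ (s : ℂ))

/-- `c` is a constant in the decay bound `|E_{α,β}(-t^α z^s)| ≤ c / (1 + t^α |z|^s)` on the
imaginary axis. -/
def IsDecayConst (α β t s c : ℝ) : Prop :=
  0 < c ∧ ∀ z : ℂ, z.re = 0 → ‖fracML α β t s z‖ ≤ c / (1 + t ^ α * ‖z‖ ^ s)

/-- The integrand `|f(z) / (z + l)|` at the point `z = i y` of the imaginary axis. -/
noncomputable def imagAxisIntegrand (f : ℂ → ℂ) (l : ℝ) (y : ℝ) : ℝ :=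
  ‖f (y * Complex.I) / (y * Complex.I + l)‖

/-- The constant `c_f = ∫_{iℝ} |f(z) / (z + l)| |dz|`, the imaginary axis being parametrized
by arc length. It is meaningful when the integrand is integrable. -/
noncomputable def imagAxisConst (f : ℂ → ℂ) (l : ℝ) : ℝ :=
  ∫ y : ℝ, imagAxisIntegrand f l y

/-! Hankel's formula for 1/Γ, summed against the geometric series, gives E_{α,β}(z) = (2πi)⁻¹ ∫ e^ζ
ζ^(α-β) / (ζ^α - z) dζ. In the coordinate ζ = exp w the contour becomes three sides of a half-strip
|Im w| ≤ φ, with π/2 < φ < π so that e^ζ decays along the two rays.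

If |arg z| ≥ θ > αφ, then ζ^α and z have arguments a fixed angle apart, so |ζ^α - z| ≥ κ(1 + |z|)
for |ζ| ≥ 1. The contour may thus start at |ζ| = 1, and since β ≥ α the numerator there is dominated
independently of β. This yields the decay c / (1 + |z|) of `exists_norm_mittagLeffler_le`. For λ ∈
iℝ the point -t^α λ^s has argument ±(π - sπ/2), and a suitable φ exists exactly when σ + α < 2.

For c_f, |iy + l| is bounded below by l when |y| ≤ 1 and by |y| when |y| > 1; the tail is then an
explicit logarithmic integral. -/

open Filter Topology Set Complex Asymptotics

/-! ### The kernel and its integrals over horizontal lines -/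

/-- The integrand `exp (exp w) * exp (p w)`: Hankel's integrand `e^ζ ζ^(p-1) dζ` in the
logarithmic coordinate `ζ = exp w`. -/
noncomputable def hankelKernel (p : ℝ) (w : ℂ) : ℂ := cexp (cexp w) * cexp (p * w)

lemma norm_hankelKernel (p x y : ℝ) :
    ‖hankelKernel p (x + y * I)‖ = Real.exp (Real.exp x * Real.cos y + p * x) := by
  rw [hankelKernel, norm_mul, Complex.norm_exp, Complex.norm_exp, Real.exp_add, Complex.exp_re]
  simp

lemma differentiable_hankelKernel (p : ℝ) : Differentiable ℂ (hankelKernel p) := by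
  unfold hankelKernel; fun_prop

lemma continuous_hankelKernel (p : ℝ) : Continuous (hankelKernel p) :=
  (differentiable_hankelKernel p).continuous

lemma continuous_hankelKernel_horizontal (p y : ℝ) :
    Continuous fun x : ℝ => hankelKernel p (x + y * I) :=
  (continuous_hankelKernel p).comp (by fun_prop)

lemma eventually_mul_add_mul_le_neg {c : ℝ} (hc : c < 0) (p : ℝ) :
    ∀ᶠ x : ℝ in atTop, Real.exp x * c + p * x ≤ -1 * x := by
  have h : (fun x : ℝ => (p + 1) * x) =o[atTop] Real.exp := by
    simpa using (Real.isLittleO_pow_exp_atTop (n := 1)).const_mul_left (p + 1)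
  filter_upwards [h.bound (neg_pos.2 hc)] with x hx
  rw [Real.norm_eq_abs, Real.norm_eq_abs, abs_of_pos (Real.exp_pos x)] at hx
  nlinarith [le_abs_self ((p + 1) * x)]

lemma integrableOn_exp_mul_add_mul_Ioi {c : ℝ} (hc : c < 0) (p a : ℝ) :
    IntegrableOn (fun x : ℝ => Real.exp (Real.exp x * c + p * x)) (Ioi a) := by
  refine integrable_of_isBigO_exp_neg one_pos (Continuous.continuousOn (by fun_prop)) ?_
  refine IsBigO.of_bound 1 ?_
  filter_upwards [eventually_mul_add_mul_le_neg hc p] with x hx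
  simpa using hx

lemma integrableOn_hankelKernel_Ioi {y : ℝ} (hy : Real.cos y < 0) (p a : ℝ) :
    IntegrableOn (fun x : ℝ => hankelKernel p (x + y * I)) (Ioi a) := by
  refine (integrable_norm_iff
    (continuous_hankelKernel_horizontal p y).aestronglyMeasurable).1 ?_
  simp only [norm_hankelKernel]
  exact integrableOn_exp_mul_add_mul_Ioi hy p a

lemma integrable_hankelKernel {p : ℝ} (hp : 0 < p) {y : ℝ} (hy : Real.cos y < 0) :
    Integrable (fun x : ℝ => hankelKernel p (x + y * I)) := by
  rw [← integrableOn_univ, ← Iic_union_Ioi (a := (0 : ℝ))]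
  refine IntegrableOn.union ?_ (integrableOn_hankelKernel_Ioi hy p 0)
  refine (integrableOn_exp_mul_Iic hp 0).mono'
    (continuous_hankelKernel_horizontal p y).aestronglyMeasurable ?_
  refine Eventually.of_forall fun x => ?_
  rw [norm_hankelKernel]
  exact Real.exp_le_exp.2 (by nlinarith [Real.exp_pos x])

lemma tendsto_exp_exp_mul_add_mul_atTop {c : ℝ} (hc : c < 0) (p : ℝ) :
    Tendsto (fun x : ℝ => Real.exp (Real.exp x * c + p * x)) atTop (𝓝 0) := by
  refine Real.tendsto_exp_atBot.comp (tendsto_atBot_mono' atTop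
    (eventually_mul_add_mul_le_neg hc p) ?_)
  exact tendsto_id.const_mul_atTop_of_neg (by norm_num)

/-- The integral of the kernel along a horizontal line does not depend on the height, as long as
the kernel decays on the strip between the lines. -/
lemma integral_hankelKernel_horizontal_eq {p : ℝ} (hp : 0 < p) {c y₁ y₂ : ℝ} (hc : c < 0)
    (h : ∀ y ∈ uIcc y₁ y₂, Real.cos y ≤ c) :
    ∫ x : ℝ, hankelKernel p (x + y₁ * I) = ∫ x : ℝ, hankelKernel p (x + y₂ * I) := by
  have vert (l : Filter ℝ) (u : ℝ → ℝ) (k : ℝ → ℝ) (hk : Tendsto k l (𝓝 0))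
      (hb : ∀ T, ∀ y ∈ uIcc y₁ y₂, ‖hankelKernel p (u T + y * I)‖ ≤ k T) :
      Tendsto (fun T => ∫ y in y₁..y₂, hankelKernel p (u T + y * I)) l (𝓝 0) := by
    refine squeeze_zero_norm (a := fun T => k T * |y₂ - y₁|) (fun T => ?_)
      (by simpa using hk.mul_const |y₂ - y₁|)
    exact intervalIntegral.norm_integral_le_of_norm_le_const
      fun y hy => hb T y (uIoc_subset_uIcc hy)
  -- On the right the decay comes from `c < 0`, on the left from `p > 0` alone.
  have hR := vert atTop id _ (tendsto_exp_exp_mul_add_mul_atTop hc p) (fun T y hy => by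
    rw [norm_hankelKernel]
    exact Real.exp_le_exp.2 (by
      have := mul_le_mul_of_nonneg_left (h y hy) (Real.exp_pos T).le
      simp only [id]; linarith))
  have hL := vert atTop (fun T => -T) (fun T => Real.exp (-p * T))
    (Real.tendsto_exp_atBot.comp (tendsto_id.const_mul_atTop_of_neg (by linarith)))
    (fun T y hy => by
      rw [norm_hankelKernel]
      exact Real.exp_le_exp.2 (by nlinarith [h y hy, Real.exp_pos (-T)]))
  have h1 := intervalIntegral_tendsto_integral
    (integrable_hankelKernel hp ((h y₁ left_mem_uIcc).trans_lt hc))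
    tendsto_neg_atTop_atBot tendsto_id
  have h2 := intervalIntegral_tendsto_integral
    (integrable_hankelKernel hp ((h y₂ right_mem_uIcc).trans_lt hc))
    tendsto_neg_atTop_atBot tendsto_id
  have h3 := ((h1.sub h2).add (hR.const_mul I)).sub (hL.const_mul I)
  have h4 : ∀ T : ℝ, _ := fun T : ℝ =>
    integral_boundary_rect_eq_zero_of_differentiableOn (hankelKernel p)
    ((-T : ℝ) + y₁ * I) (T + y₂ * I) (differentiable_hankelKernel p).differentiableOn
  simp only [add_re, add_im, mul_re, mul_im, ofReal_re, ofReal_im, I_re, I_im, mul_zero, mul_one,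
    sub_zero, add_zero, zero_add, smul_eq_mul] at h4
  have h5 := tendsto_nhds_unique (h3.congr h4) tendsto_const_nhds
  simpa [sub_eq_zero] using h5

lemma integral_exp_neg_exp_mul_exp (p : ℝ) (hp : 0 < p) :
    ∫ x : ℝ, Real.exp (-Real.exp x) * Real.exp (p * x) = Real.Gamma p := by
  have h := integral_image_eq_integral_abs_deriv_smul (s := univ) MeasurableSet.univ
    (fun x _ => (Real.hasDerivAt_exp x).hasDerivWithinAt) Real.exp_injective.injOn
    (fun r => Real.exp (-r) * r ^ (p - 1))
  rw [image_univ, Real.range_exp, ← Real.Gamma_eq_integral hp, setIntegral_univ] at h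
  rw [h]
  refine integral_congr_ae (Eventually.of_forall fun x => ?_)
  simp only [smul_eq_mul, abs_of_pos (Real.exp_pos x), ← Real.exp_mul]
  rw [← Real.exp_add, ← Real.exp_add, ← Real.exp_add]
  ring_nf

/-- At heights ±π, exp w = -exp x, so the kernel is Euler's Gamma integrand in the variable log r,
times a constant phase. -/
lemma integral_hankelKernel_of_exp_eq_neg_one {p : ℝ} (hp : 0 < p) {y : ℝ}
    (hy : cexp (y * I) = -1) :
    ∫ x : ℝ, hankelKernel p (x + y * I) = cexp (p * y * I) * Real.Gamma p := by
  rw [← integral_exp_neg_exp_mul_exp p hp, ← integral_complex_ofReal, ← integral_const_mul]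
  refine integral_congr_ae (Eventually.of_forall fun x => ?_)
  simp only [hankelKernel]
  rw [Complex.exp_add, hy, mul_add, Complex.exp_add]
  push_cast
  ring_nf

/-! ### The Hankel contour: deformation, limits and bounds -/

/-- The integral of `g` along the Hankel contour in the logarithmic coordinate: from `∞ - iφ` to
`a - iφ`, up to `a + iφ`, and on to `∞ + iφ`. -/
noncomputable def hankelIntegral (φ a : ℝ) (g : ℂ → ℂ) : ℂ :=
  I * (∫ y in -φ..φ, g (a + y * I)) +
    ((∫ x in Ioi a, g (x + φ * I)) - ∫ x in Ioi a, g (x + (-φ : ℝ) * I))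

/-- Cauchy's theorem on the rectangle between the two vertical sides; beyond it the contours
coincide. -/
lemma hankelIntegral_eq_of_le {φ a b : ℝ} {g : ℂ → ℂ} (hab : a ≤ b)
    (hg : DifferentiableOn ℂ g (uIcc a b ×ℂ uIcc (-φ) φ))
    (h₁ : IntegrableOn (fun x : ℝ => g (x + φ * I)) (Ioi a))
    (h₂ : IntegrableOn (fun x : ℝ => g (x + (-φ : ℝ) * I)) (Ioi a)) :
    hankelIntegral φ a g = hankelIntegral φ b g := by
  have h := integral_boundary_rect_eq_zero_of_differentiableOn g
    (a + (-φ : ℝ) * I) (b + φ * I) (by simpa using hg)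
  simp only [add_re, add_im, mul_re, mul_im, ofReal_re, ofReal_im, I_re, I_im, mul_zero, mul_one,
    sub_zero, add_zero, zero_add, smul_eq_mul] at h
  rw [← intervalIntegral.integral_Ioi_sub_Ioi h₁ hab,
    ← intervalIntegral.integral_Ioi_sub_Ioi h₂ hab] at h
  unfold hankelIntegral
  linear_combination -h

/-- Dominated convergence along the Hankel contour. -/
lemma tendsto_hankelIntegral {ι : Type*} {l : Filter ι} [l.IsCountablyGenerated] {φ a C q : ℝ}
    (hφ : Real.cos φ < 0) (hφ0 : 0 ≤ φ) {F : ι → ℂ → ℂ} {g : ℂ → ℂ} (hF : ∀ i, Continuous (F i))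
    (hb : ∀ᶠ i in l, ∀ w : ℂ, a ≤ w.re → |w.im| ≤ φ → ‖F i w‖ ≤ C * ‖hankelKernel q w‖)
    (ht : ∀ w : ℂ, a ≤ w.re → |w.im| ≤ φ → Tendsto (fun i => F i w) l (𝓝 (g w))) :
    Tendsto (fun i => hankelIntegral φ a (F i)) l (𝓝 (hankelIntegral φ a g)) := by
  have horiz (y : ℝ) (hy : |y| ≤ φ) (hc : Real.cos y < 0) :
      Tendsto (fun i => ∫ x in Ioi a, F i (x + y * I)) l (𝓝 (∫ x in Ioi a, g (x + y * I))) := by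
    refine tendsto_integral_filter_of_dominated_convergence
      (fun x => C * ‖hankelKernel q (x + y * I)‖) (Eventually.of_forall fun i =>
        ((hF i).comp (by fun_prop)).aestronglyMeasurable) ?_
      ((integrableOn_hankelKernel_Ioi hc q a).norm.const_mul C) ?_
    · filter_upwards [hb] with i hi
      filter_upwards [ae_restrict_mem measurableSet_Ioi] with x hx
      exact hi _ (by simpa using (mem_Ioi.1 hx).le) (by simpa using hy)
    · filter_upwards [ae_restrict_mem measurableSet_Ioi] with x hx
      exact ht _ (by simpa using (mem_Ioi.1 hx).le) (by simpa using hy)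
  have vert : Tendsto (fun i => ∫ y in -φ..φ, F i (a + y * I)) l
      (𝓝 (∫ y in -φ..φ, g (a + y * I))) := by
    have key (y : ℝ) (hy : y ∈ uIoc (-φ) φ) : |y| ≤ φ := by
      rw [uIoc_of_le (by linarith)] at hy
      exact abs_le.2 ⟨hy.1.le, hy.2⟩
    refine intervalIntegral.tendsto_integral_filter_of_dominated_convergence
      (fun y => C * ‖hankelKernel q (a + y * I)‖) (Eventually.of_forall fun i =>
        ((hF i).comp (by fun_prop)).aestronglyMeasurable) ?_ ?_ ?_
    · filter_upwards [hb] with i hi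
      exact Eventually.of_forall fun y hy => hi _ (by simp) (by simpa using key y hy)
    · exact Continuous.intervalIntegrable (continuous_const.mul
        ((continuous_hankelKernel q).comp (by fun_prop)).norm) _ _
    · exact Eventually.of_forall fun y hy => ht _ (by simp) (by simpa using key y hy)
  exact (vert.const_mul I).add ((horiz φ (abs_of_nonneg hφ0).le hφ).sub
    (horiz (-φ) (by rw [abs_neg, abs_of_nonneg hφ0]) (by rwa [Real.cos_neg])))

/-- A function dominated by a multiple of the kernel has a correspondingly bounded integral. -/
lemma norm_hankelIntegral_le {φ a C q : ℝ} (hφ : Real.cos φ < 0) (hφ0 : 0 ≤ φ) {g : ℂ → ℂ}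
    (hb : ∀ w : ℂ, a ≤ w.re → |w.im| ≤ φ → ‖g w‖ ≤ C * ‖hankelKernel q w‖) :
    ‖hankelIntegral φ a g‖ ≤ C * ((∫ y in -φ..φ, ‖hankelKernel q (a + y * I)‖) +
      ((∫ x in Ioi a, ‖hankelKernel q (x + φ * I)‖) +
        ∫ x in Ioi a, ‖hankelKernel q (x + (-φ : ℝ) * I)‖)) := by
  have horiz (y : ℝ) (hy : |y| ≤ φ) (hc : Real.cos y < 0) :
      ‖∫ x in Ioi a, g (x + y * I)‖ ≤ C * ∫ x in Ioi a, ‖hankelKernel q (x + y * I)‖ := by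
    rw [← integral_const_mul]
    refine norm_integral_le_of_norm_le ((integrableOn_hankelKernel_Ioi hc q a).norm.const_mul C) ?_
    filter_upwards [ae_restrict_mem measurableSet_Ioi] with x hx
    exact hb _ (by simpa using (mem_Ioi.1 hx).le) (by simpa using hy)
  have vert : ‖∫ y in -φ..φ, g (a + y * I)‖ ≤ C * ∫ y in -φ..φ, ‖hankelKernel q (a + y * I)‖ := by
    rw [← intervalIntegral.integral_const_mul]
    refine intervalIntegral.norm_integral_le_of_norm_le (by linarith) (Eventually.of_forall
      fun y hy => hb _ (by simp) (by simpa using abs_le.2 ⟨hy.1.le, hy.2⟩)) ?_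
    exact Continuous.intervalIntegrable (continuous_const.mul
      ((continuous_hankelKernel q).comp (by fun_prop)).norm) _ _
  have h1 := horiz φ (abs_of_nonneg hφ0).le hφ
  have h2 := horiz (-φ) (by rw [abs_neg, abs_of_nonneg hφ0]) (by rwa [Real.cos_neg])
  unfold hankelIntegral
  refine (norm_add_le _ _).trans ((add_le_add le_rfl (norm_sub_le _ _)).trans ?_)
  rw [norm_mul, norm_I, one_mul]
  linarith

/-! ### Hankel's formula for 1/Γ -/

lemma hankelIntegral_kernel_eq_of_le {φ a b : ℝ} (hφ : Real.cos φ < 0) (p : ℝ) (hab : a ≤ b) :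
    hankelIntegral φ a (hankelKernel p) = hankelIntegral φ b (hankelKernel p) :=
  hankelIntegral_eq_of_le hab (differentiable_hankelKernel p).differentiableOn
    (integrableOn_hankelKernel_Ioi hφ p a)
    (integrableOn_hankelKernel_Ioi (by rwa [Real.cos_neg]) p a)

lemma hankelIntegral_kernel_eq {φ : ℝ} (hφ : Real.cos φ < 0) (p a b : ℝ) :
    hankelIntegral φ a (hankelKernel p) = hankelIntegral φ b (hankelKernel p) := by
  rcases le_total a b with h | h
  · exact hankelIntegral_kernel_eq_of_le hφ p h
  · exact (hankelIntegral_kernel_eq_of_le hφ p h).symm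

/-- As a → -∞ the vertical side vanishes because p > 0, leaving two full lines. Moved to heights ±π,
they differ by 2i sin(πp) Γ(p), and the reflection formula concludes. -/
lemma hankelIntegral_kernel_of_pos_of_lt_one {φ : ℝ} (h₁ : Real.pi / 2 < φ) (h₂ : φ < Real.pi)
    {p : ℝ} (hp : 0 < p) (hp1 : p < 1) (a : ℝ) :
    hankelIntegral φ a (hankelKernel p) = 2 * Real.pi * I / Real.Gamma (1 - p) := by
  have hpi := Real.pi_pos
  have hφ : Real.cos φ < 0 := Real.cos_neg_of_pi_div_two_lt_of_lt h₁ (by linarith)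
  have hφ' : Real.cos (-φ) < 0 := by rwa [Real.cos_neg]
  have top : ∫ x : ℝ, hankelKernel p (x + φ * I) =
      cexp (p * Real.pi * I) * Real.Gamma p := by
    rw [integral_hankelKernel_horizontal_eq (y₂ := Real.pi) hp hφ]
    · exact integral_hankelKernel_of_exp_eq_neg_one hp Complex.exp_pi_mul_I
    · intro y hy
      rw [uIcc_of_le h₂.le] at hy
      exact Real.cos_le_cos_of_nonneg_of_le_pi (by linarith) hy.2 hy.1
  have bot : ∫ x : ℝ, hankelKernel p (x + (-φ : ℝ) * I) =
      cexp (p * (-Real.pi : ℝ) * I) * Real.Gamma p := by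
    rw [integral_hankelKernel_horizontal_eq (y₂ := -Real.pi) hp hφ]
    · refine integral_hankelKernel_of_exp_eq_neg_one hp ?_
      rw [ofReal_neg, neg_mul, Complex.exp_neg, Complex.exp_pi_mul_I]; norm_num
    · intro y hy
      rw [uIcc_of_ge (by linarith)] at hy
      rw [← Real.cos_neg y]
      exact Real.cos_le_cos_of_nonneg_of_le_pi (by linarith) (by linarith [hy.1])
        (by linarith [hy.2])
  have vert : Tendsto (fun a : ℝ => ∫ y in -φ..φ, hankelKernel p (a + y * I)) atBot (𝓝 0) := by
    have h0 : Tendsto (fun a : ℝ => Real.exp (Real.exp a + p * a)) atBot (𝓝 0) :=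
      Real.tendsto_exp_atBot.comp
        (Real.tendsto_exp_atBot.add_atBot (tendsto_id.const_mul_atBot hp))
    refine squeeze_zero_norm (a := fun a : ℝ => Real.exp (Real.exp a + p * a) * |φ - -φ|)
      (fun a => ?_) (by simpa using h0.mul_const |φ - -φ|)
    refine intervalIntegral.norm_integral_le_of_norm_le_const fun y _ => ?_
    rw [norm_hankelKernel]
    exact Real.exp_le_exp.2 (by nlinarith [Real.exp_pos a, Real.cos_le_one y])
  have lim := (vert.const_mul I).add
    (((aecover_Ioi tendsto_id).integral_tendsto_of_countably_generated
      (integrable_hankelKernel hp hφ)).sub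
    ((aecover_Ioi tendsto_id).integral_tendsto_of_countably_generated
      (integrable_hankelKernel hp hφ')))
  rw [top, bot] at lim
  -- The contour integral does not depend on its left end, so it equals its limit at -∞.
  have h := tendsto_nhds_unique (tendsto_const_nhds.congr
    fun b => hankelIntegral_kernel_eq hφ p a b) lim
  rw [h]
  have hr := Complex.Gamma_mul_Gamma_one_sub (p : ℂ)
  have hs : Complex.sin (Real.pi * p) ≠ 0 := by
    rw [← ofReal_mul, ← ofReal_sin, ofReal_ne_zero]
    exact (Real.sin_pos_of_pos_of_lt_pi (by positivity) (by nlinarith)).ne'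
  have hg : Complex.Gamma (1 - p) ≠ 0 := by
    apply Complex.Gamma_ne_zero_of_re_pos; simpa using hp1
  rw [eq_div_iff hs] at hr
  rw [← Complex.Gamma_ofReal, ← Complex.Gamma_ofReal]
  push_cast
  rw [eq_div_iff hg]
  rw [Complex.sin] at hr
  have e1 : (p : ℂ) * Real.pi * I = Real.pi * p * I := by ring
  have e2 : (p : ℂ) * -Real.pi * I = -(Real.pi * p) * I := by ring
  rw [e1, e2]
  linear_combination 2 * I * hr + Complex.Gamma p * Complex.Gamma (1 - p) *
    (cexp (Real.pi * p * I) - cexp (-(Real.pi * p) * I)) * I_mul_I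

lemma hasDerivAt_hankelKernel (p : ℝ) (w : ℂ) :
    HasDerivAt (hankelKernel p) (hankelKernel (p + 1) w + p * hankelKernel p w) w := by
  have h := ((Complex.hasDerivAt_exp w).cexp).mul (((hasDerivAt_id w).const_mul (p : ℂ)).cexp)
  refine h.congr_deriv ?_
  simp only [hankelKernel, id, ofReal_add, ofReal_one, add_mul, one_mul, Complex.exp_add]
  ring

lemma tendsto_hankelKernel_horizontal {y : ℝ} (hy : Real.cos y < 0) (p : ℝ) :
    Tendsto (fun x : ℝ => hankelKernel p (x + y * I)) atTop (𝓝 0) := by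
  rw [tendsto_zero_iff_norm_tendsto_zero]
  simp only [norm_hankelKernel]
  exact tendsto_exp_exp_mul_add_mul_atTop hy p

/-- Integration by parts along the Hankel contour. -/
lemma hankelIntegral_kernel_add_one {φ : ℝ} (hφ : Real.cos φ < 0) (p a : ℝ) :
    hankelIntegral φ a (hankelKernel (p + 1)) = -p * hankelIntegral φ a (hankelKernel p) := by
  have horiz (y : ℝ) (hy : Real.cos y < 0) :
      (∫ x in Ioi a, hankelKernel (p + 1) (x + y * I)) +
        p * ∫ x in Ioi a, hankelKernel p (x + y * I) = 0 - hankelKernel p (a + y * I) := by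
    have i1 := integrableOn_hankelKernel_Ioi hy (p + 1) a
    have i2 := (integrableOn_hankelKernel_Ioi hy p a).const_mul (p : ℂ)
    rw [← integral_const_mul, ← integral_add i1 i2]
    refine integral_Ioi_of_hasDerivAt_of_tendsto' (fun x _ => ?_) (i1.add i2)
      (tendsto_hankelKernel_horizontal hy p)
    have h := (hasDerivAt_hankelKernel p (x + y * I)).comp_of_eq (x : ℂ)
      ((hasDerivAt_id (x : ℂ)).add_const (y * I)) rfl
    simpa using! h.comp_ofReal
  have vert : I * (∫ y in -φ..φ, hankelKernel (p + 1) (a + y * I)) +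
      p * (I * ∫ y in -φ..φ, hankelKernel p (a + y * I)) =
        hankelKernel p (a + φ * I) - hankelKernel p (a + (-φ : ℝ) * I) := by
    have c1 (q : ℝ) : Continuous fun y : ℝ => hankelKernel q (a + y * I) :=
      (continuous_hankelKernel q).comp (by fun_prop)
    rw [← intervalIntegral.integral_eq_sub_of_hasDerivAt (a := -φ) (b := φ)
      (f := fun y : ℝ => hankelKernel p (a + y * I))
      (f' := fun y : ℝ => I * hankelKernel (p + 1) (a + y * I) +
        p * (I * hankelKernel p (a + y * I)))]
    · rw [intervalIntegral.integral_add, intervalIntegral.integral_const_mul,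
        intervalIntegral.integral_const_mul, intervalIntegral.integral_const_mul]
      · exact ((c1 _).const_mul I).intervalIntegrable _ _
      · exact (((c1 _).const_mul I).const_mul _).intervalIntegrable _ _
    · intro y _
      have h := (hasDerivAt_hankelKernel p (a + y * I)).comp_of_eq (y : ℂ)
        (((hasDerivAt_id (y : ℂ)).mul_const I).const_add (a : ℂ)) rfl
      refine h.comp_ofReal.congr_deriv ?_
      ring
    · exact (((c1 _).const_mul I).add (((c1 _).const_mul I).const_mul _)).intervalIntegrable _ _
  have h1 := horiz φ hφ
  have h2 := horiz (-φ) (by rwa [Real.cos_neg])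
  unfold hankelIntegral
  linear_combination h1 - h2 + vert

/-- On Re w ≥ 0 one kernel dominates all those of smaller exponent; this is the source of uniformity
in β. -/
lemma norm_hankelKernel_le_of_le {p q : ℝ} (hpq : p ≤ q) {w : ℂ} (hw : 0 ≤ w.re) :
    ‖hankelKernel p w‖ ≤ ‖hankelKernel q w‖ := by
  rw [← Complex.re_add_im w, norm_hankelKernel, norm_hankelKernel]
  exact Real.exp_le_exp.2 (by nlinarith)

/-- Neither reflection (0 < p < 1) nor the recurrence from positive arguments of Γ reaches p = 0, so
it is obtained by letting p → 0⁺. -/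
lemma hankelIntegral_kernel_zero {φ : ℝ} (h₁ : Real.pi / 2 < φ) (h₂ : φ < Real.pi) :
    hankelIntegral φ 0 (hankelKernel 0) = 2 * Real.pi * I / Real.Gamma (1 - 0) := by
  have hpi := Real.pi_pos
  have hφ : Real.cos φ < 0 := Real.cos_neg_of_pi_div_two_lt_of_lt h₁ (by linarith)
  have ev : ∀ᶠ p : ℝ in 𝓝[>] 0, p < 1 ∧ 0 < p := by
    filter_upwards [self_mem_nhdsWithin, mem_nhdsWithin_of_mem_nhds (Iio_mem_nhds one_pos)]
      with p hp hp1 using ⟨hp1, hp⟩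
  have lim : Tendsto (fun p : ℝ => hankelIntegral φ 0 (hankelKernel p)) (𝓝[>] 0)
      (𝓝 (hankelIntegral φ 0 (hankelKernel 0))) := by
    refine tendsto_hankelIntegral (C := 1) (q := 1) hφ (by linarith)
      (fun p => continuous_hankelKernel p) ?_ fun w _ _ => ?_
    · filter_upwards [ev] with p hp w hw _
      rw [one_mul]
      exact norm_hankelKernel_le_of_le hp.1.le hw
    · have : Continuous fun p : ℝ => hankelKernel p w := by unfold hankelKernel; fun_prop
      exact this.continuousWithinAt
  have lim2 : Tendsto (fun p : ℝ => 2 * Real.pi * I / (Real.Gamma (1 - p) : ℂ)) (𝓝[>] 0)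
      (𝓝 (2 * Real.pi * I / Real.Gamma (1 - 0))) := by
    have hG : ContinuousAt Real.Gamma (1 - 0) :=
      (Real.differentiableAt_Gamma fun m => by
        have : (0 : ℝ) ≤ m := m.cast_nonneg
        linarith).continuousAt
    have hG' : ContinuousAt (fun p : ℝ => Real.Gamma (1 - p)) 0 :=
      ContinuousAt.comp (f := fun p : ℝ => 1 - p) hG (by fun_prop)
    refine ContinuousAt.continuousWithinAt (f := fun p : ℝ =>
      2 * Real.pi * I / (Real.Gamma (1 - p) : ℂ)) (ContinuousAt.div continuousAt_const
      (continuous_ofReal.continuousAt.comp hG') ?_)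
    simp
  refine tendsto_nhds_unique (lim.congr' ?_) lim2
  filter_upwards [ev] with p hp
  exact hankelIntegral_kernel_of_pos_of_lt_one h₁ h₂ hp.2 hp.1 0

/-- Hankel's formula for the reciprocal of the Gamma function. -/
theorem hankelIntegral_kernel {φ : ℝ} (h₁ : Real.pi / 2 < φ) (h₂ : φ < Real.pi)
    {s : ℝ} (hs : 0 < s) (a : ℝ) :
    hankelIntegral φ a (hankelKernel (1 - s)) = 2 * Real.pi * I / Real.Gamma s := by
  have hφ : Real.cos φ < 0 :=
    Real.cos_neg_of_pi_div_two_lt_of_lt h₁ (by linarith [Real.pi_pos])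
  obtain ⟨n, hn⟩ := exists_nat_gt s
  -- Induction on unit intervals: integration by parts lowers s by one, matching Γ(s) = (s - 1) Γ(s
  -- - 1).
  have key (n : ℕ) : ∀ s : ℝ, 0 < s → s ≤ n + 1 →
      hankelIntegral φ a (hankelKernel (1 - s)) = 2 * Real.pi * I / Real.Gamma s := by
    induction n with
    | zero =>
      intro s hs hs1
      rcases eq_or_lt_of_le hs1 with h | h
      · obtain rfl : s = 1 := by simpa using h
        rw [hankelIntegral_kernel_eq hφ _ a 0, sub_self, hankelIntegral_kernel_zero h₁ h₂, sub_zero]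
      · rw [hankelIntegral_kernel_of_pos_of_lt_one h₁ h₂ _ (by linarith), sub_sub_cancel]
        simp at h; linarith
    | succ n ih =>
      intro s hs hs1
      rcases le_or_gt s 1 with h | h
      · refine ih s hs (by linarith [n.cast_nonneg (α := ℝ)])
      · have hi := ih (s - 1) (by linarith) (by push_cast at hs1; linarith)
        have hr := hankelIntegral_kernel_add_one hφ (1 - s) a
        rw [show 1 - s + 1 = 1 - (s - 1) by ring, hi] at hr
        have hg : Real.Gamma s = (s - 1) * Real.Gamma (s - 1) := by
          rw [← Real.Gamma_add_one (by linarith), sub_add_cancel]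
        have hs1' : ((s : ℂ) - 1) ≠ 0 := by
          rw [← ofReal_one, ← ofReal_sub, ofReal_ne_zero]; linarith
        have : ((-(1 - s : ℝ) : ℂ)) = s - 1 := by push_cast; ring
        rw [this] at hr
        rw [hg, ofReal_mul, ofReal_sub, ofReal_one, mul_comm ((s : ℂ) - 1), ← div_div, hr,
          mul_div_cancel_left₀ _ hs1']
  exact key n s hs (by linarith)

/-! ### Lower bound for the denominator -/

/-- Two complex numbers in polar form whose arguments stay apart do not cancel. -/
lemma norm_polar_sub_polar_ge {κ u v A B : ℝ} (hκ : -1 ≤ κ) (hκ1 : κ ≤ 1) (hu : 0 ≤ u)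
    (hv : 0 ≤ v) (h : Real.cos (A - B) ≤ κ) :
    √((1 - κ) / 2) * (u + v) ≤ ‖(u : ℂ) * cexp (A * I) - v * cexp (B * I)‖ := by
  refine Real.le_sqrt_of_sq_le ?_ |>.trans_eq (by rw [Complex.norm_def])
  rw [mul_pow, Real.sq_sqrt (by linarith), Complex.exp_mul_I, Complex.exp_mul_I,
    ← ofReal_cos, ← ofReal_cos, ← ofReal_sin, ← ofReal_sin, Complex.normSq_apply]
  simp only [sub_re, sub_im, mul_re, mul_im, add_re, add_im, ofReal_re, ofReal_im, I_re, I_im]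
  rw [Real.cos_sub] at h
  have h1 := Real.sin_sq_add_cos_sq A
  have h2 := Real.sin_sq_add_cos_sq B
  have h3 := mul_le_mul_of_nonneg_left h (mul_nonneg hu hv)
  -- u² + v² - 2κuv exceeds (1 - κ)(u + v)²/2 by exactly (1 + κ)(u - v)²/2.
  have h4 : 0 ≤ (1 + κ) * (u - v) ^ 2 := mul_nonneg (by linarith) (sq_nonneg _)
  have e : (u * Real.cos A - v * Real.cos B) ^ 2 + (u * Real.sin A - v * Real.sin B) ^ 2 =
      u ^ 2 + v ^ 2 - 2 * (u * v * (Real.cos A * Real.cos B + Real.sin A * Real.sin B)) := by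
    linear_combination u ^ 2 * h1 + v ^ 2 * h2
  nlinarith [e]

/-- exp(αw) has modulus at least 1 and argument at most αφ in absolute value, so its angle to the
other point is at least δ = θ - αφ; the constant is sin(δ/2). -/
lemma norm_exp_sub_polar_ge {α φ θ v B : ℝ} (hα : 0 < α) (hφ : 0 ≤ φ) (hθ : α * φ ≤ θ)
    (hθπ : θ ≤ Real.pi) (hv : 0 ≤ v) (hB : θ ≤ |B|) (hBπ : |B| ≤ Real.pi) {w : ℂ}
    (hw : 0 ≤ w.re) (hw' : |w.im| ≤ φ) :
    √((1 - Real.cos (θ - α * φ)) / 2) * (1 + v) ≤ ‖cexp (α * w) - v * cexp (B * I)‖ := by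
  have e : cexp (α * w) = (Real.exp (α * w.re) : ℝ) * cexp ((α * w.im : ℝ) * I) := by
    rw [ofReal_exp, ← Complex.exp_add]
    conv_lhs => rw [← Complex.re_add_im w]
    push_cast; ring_nf
  have hA : |α * w.im| ≤ α * φ := by
    rw [abs_mul, abs_of_pos hα]; exact mul_le_mul_of_nonneg_left hw' hα.le
  have h1 : 1 ≤ Real.exp (α * w.re) := Real.one_le_exp (by positivity)
  have hαφ : 0 ≤ α * φ := by positivity
  rw [e]
  refine le_trans ?_ (norm_polar_sub_polar_ge (Real.neg_one_le_cos (θ - α * φ))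
    (Real.cos_le_one _) (Real.exp_pos _).le hv ?_)
  · exact mul_le_mul_of_nonneg_left (by linarith) (Real.sqrt_nonneg _)
  · rw [← Real.cos_abs (α * w.im - B)]
    have l1 : θ - α * φ ≤ |α * w.im - B| := by
      have := abs_sub_abs_le_abs_sub B (α * w.im)
      rw [abs_sub_comm] at this
      linarith
    have l2 : |α * w.im - B| ≤ α * φ + Real.pi := (abs_sub _ _).trans (add_le_add hA hBπ)
    -- A difference of arguments above π is replaced by its complement to 2π, which is at least π -
    -- αφ ≥ θ - αφ.
    rcases le_or_gt |α * w.im - B| Real.pi with h | h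
    · exact Real.cos_le_cos_of_nonneg_of_le_pi (by linarith) h l1
    · rw [← Real.cos_two_pi_sub |α * w.im - B|]
      exact Real.cos_le_cos_of_nonneg_of_le_pi (by linarith) (by linarith) (by linarith)

/-! ### The Mittag-Leffler function as a Hankel integral -/

lemma hankelKernel_sub_mul_natCast (p α : ℝ) (k : ℕ) (w : ℂ) :
    hankelKernel (p - α * k) w = hankelKernel p w * cexp (-(α * w)) ^ k := by
  simp only [hankelKernel]
  rw [← Complex.exp_nat_mul, mul_assoc, ← Complex.exp_add (p * w)]
  congr 2
  push_cast; ring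

lemma hankelKernel_add (p α : ℝ) (w : ℂ) :
    hankelKernel (p + α) w = hankelKernel p w * cexp (α * w) := by
  simp only [hankelKernel]
  rw [mul_assoc, ← Complex.exp_add (p * w)]
  congr 2
  push_cast; ring

lemma hankelIntegral_const_mul (φ a : ℝ) (c : ℂ) (g : ℂ → ℂ) :
    hankelIntegral φ a (fun w => c * g w) = c * hankelIntegral φ a g := by
  simp only [hankelIntegral, integral_const_mul, intervalIntegral.integral_const_mul]
  ring

lemma hankelIntegral_sum_kernel {φ : ℝ} (hφ : Real.cos φ < 0) (a : ℝ) (s : Finset ℕ)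
    (c : ℕ → ℂ) (p : ℕ → ℝ) :
    hankelIntegral φ a (fun w => ∑ k ∈ s, c k * hankelKernel (p k) w) =
      ∑ k ∈ s, c k * hankelIntegral φ a (hankelKernel (p k)) := by
  have hφ' : Real.cos (-φ) < 0 := by rwa [Real.cos_neg]
  have hv (k : ℕ) (_ : k ∈ s) : IntervalIntegrable
      (fun y : ℝ => c k * hankelKernel (p k) (a + y * I)) volume (-φ) φ :=
    (((continuous_hankelKernel (p k)).comp (by fun_prop)).const_mul (c k)).intervalIntegrable _ _
  simp only [← hankelIntegral_const_mul]
  simp only [hankelIntegral]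
  rw [integral_finsetSum _ fun k _ => (integrableOn_hankelKernel_Ioi hφ (p k) a).const_mul (c k),
    integral_finsetSum _ fun k _ => (integrableOn_hankelKernel_Ioi hφ' (p k) a).const_mul (c k),
    intervalIntegral.integral_finsetSum hv,
    Finset.mul_sum, ← Finset.sum_sub_distrib, ← Finset.sum_add_distrib]

/-- The partial sums of the Mittag-Leffler series converge to a Hankel integral over a contour
on which `|z| < |exp (α w)|`. -/
lemma tendsto_sum_range_hankelIntegral {φ : ℝ} (h₁ : Real.pi / 2 < φ) (h₂ : φ < Real.pi)
    {α β : ℝ} (hα : 0 < α) (hβ : 0 < β) {z : ℂ} {b : ℝ} (hb : ‖z‖ < Real.exp (α * b)) :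
    Tendsto (fun n : ℕ => ∑ k ∈ Finset.range n,
      z ^ k / ((Real.Gamma (α * k + β) : ℝ) : ℂ)) atTop (𝓝 ((2 * Real.pi * I)⁻¹ *
        hankelIntegral φ b fun w => hankelKernel (1 - β + α) w / (cexp (α * w) - z))) := by
  have hφ : Real.cos φ < 0 :=
    Real.cos_neg_of_pi_div_two_lt_of_lt h₁ (by linarith [Real.pi_pos])
  set ρ := ‖z‖ * Real.exp (-(α * b)) with hρ
  have hρ0 : 0 ≤ ρ := by positivity
  have hρ1 : ρ < 1 := by
    rwa [hρ, Real.exp_neg, ← div_eq_mul_inv, div_lt_one (Real.exp_pos _)]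
  have ratio (w : ℂ) (hw : b ≤ w.re) : ‖z * cexp (-(α * w))‖ ≤ ρ := by
    rw [norm_mul, Complex.norm_exp]
    refine mul_le_mul_of_nonneg_left (Real.exp_le_exp.2 ?_) (norm_nonneg _)
    simpa using mul_le_mul_of_nonneg_left hw hα.le
  have geom (w : ℂ) (n : ℕ) :
      ∑ k ∈ Finset.range n, z ^ k * hankelKernel (1 - β - α * k) w =
        hankelKernel (1 - β) w * ∑ k ∈ Finset.range n, (z * cexp (-(α * w))) ^ k := by
    rw [Finset.mul_sum]
    refine Finset.sum_congr rfl fun k _ => ?_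
    rw [hankelKernel_sub_mul_natCast, mul_pow]; ring
  have lim : Tendsto (fun n : ℕ => hankelIntegral φ b fun w =>
      ∑ k ∈ Finset.range n, z ^ k * hankelKernel (1 - β - α * k) w) atTop
      (𝓝 (hankelIntegral φ b fun w => hankelKernel (1 - β + α) w / (cexp (α * w) - z))) := by
    -- Every partial sum of the geometric series of ratio z exp(-αw) is at most (1 - ρ)⁻¹ in norm.
    refine tendsto_hankelIntegral (C := (1 - ρ)⁻¹) (q := 1 - β) hφ (by linarith [Real.pi_pos])
      (fun n => continuous_finsetSum _ fun k _ => (continuous_hankelKernel _).const_mul _)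
      (Eventually.of_forall fun n w hw _ => ?_) fun w hw _ => ?_
    · rw [geom, norm_mul, mul_comm]
      refine mul_le_mul_of_nonneg_right ?_ (norm_nonneg _)
      refine (norm_sum_le _ _).trans ?_
      rw [← tsum_geometric_of_lt_one hρ0 hρ1]
      refine le_trans (Finset.sum_le_sum fun k _ => ?_)
        ((summable_geometric_of_lt_one hρ0 hρ1).sum_le_tsum _ fun k _ => pow_nonneg hρ0 k)
      rw [norm_pow]
      exact pow_le_pow_left₀ (norm_nonneg _) (ratio w hw) k
    · simp only [geom]
      have hlt := (ratio w hw).trans_lt hρ1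
      convert (hasSum_geometric_of_norm_lt_one hlt).tendsto_sum_nat.const_mul
        (hankelKernel (1 - β) w) using 2
      have hne : 1 - z * cexp (-(α * w)) ≠ 0 := by
        intro h
        rw [← sub_eq_zero.1 h] at hlt
        simp at hlt
      have hE : cexp (α * w) * cexp (-(α * w)) = 1 := by rw [← Complex.exp_add]; simp
      have hne' : cexp (α * w) - z = cexp (α * w) * (1 - z * cexp (-(α * w))) := by
        linear_combination z * hE
      rw [hne', hankelKernel_add, mul_comm (cexp (α * w)),
        mul_div_mul_right _ _ (Complex.exp_ne_zero _), div_eq_mul_inv]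
  refine (lim.const_mul _).congr fun n => ?_
  rw [hankelIntegral_sum_kernel hφ, Finset.mul_sum]
  refine Finset.sum_congr rfl fun k _ => ?_
  rw [show 1 - β - α * k = 1 - (α * k + β) by ring, hankelIntegral_kernel h₁ h₂ (by positivity)]
  have : (2 * Real.pi * I : ℂ) ≠ 0 := Complex.two_pi_I_ne_zero
  field_simp

lemma exists_nonneg_norm_lt_exp {α : ℝ} (hα : 0 < α) (z : ℂ) :
    ∃ b : ℝ, 0 ≤ b ∧ ‖z‖ < Real.exp (α * b) := by
  refine ⟨‖z‖ / α, by positivity, ?_⟩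
  rw [mul_div_cancel₀ _ hα.ne']
  linarith [Real.add_one_le_exp ‖z‖]

/-- At the point |z| the partial sums converge by the contour formula, and their terms are
nonnegative; this gives absolute convergence without growth estimates for Γ. -/
lemma summable_mittagLeffler {α β : ℝ} (hα : 0 < α) (hβ : 0 < β) (z : ℂ) :
    Summable fun k : ℕ => z ^ k / ((Real.Gamma (α * k + β) : ℝ) : ℂ) := by
  have hG (k : ℕ) : 0 < Real.Gamma (α * k + β) := Real.Gamma_pos_of_pos (by positivity)
  have hpi := Real.pi_pos
  obtain ⟨b, -, hb⟩ := exists_nonneg_norm_lt_exp hα (‖z‖ : ℂ)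
  have h := (continuous_re.tendsto _).comp (tendsto_sum_range_hankelIntegral (φ := 3 * Real.pi / 4)
    (by linarith) (by linarith) hα hβ hb)
  have e (n : ℕ) : (re ∘ fun n : ℕ => ∑ k ∈ Finset.range n, (‖z‖ : ℂ) ^ k /
      ((Real.Gamma (α * k + β) : ℝ) : ℂ)) n =
      ∑ k ∈ Finset.range n, ‖z‖ ^ k / Real.Gamma (α * k + β) := by
    rw [Function.comp, ← ofReal_re (∑ k ∈ Finset.range n, ‖z‖ ^ k / Real.Gamma (α * k + β))]
    push_cast; rfl
  have hs : Summable fun k : ℕ => ‖z‖ ^ k / Real.Gamma (α * k + β) :=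
    ((hasSum_iff_tendsto_nat_of_nonneg (fun k => by have := hG k; positivity) _).2
      (h.congr e)).summable
  refine hs.of_norm_bounded fun k => ?_
  rw [norm_div, norm_pow, norm_real, Real.norm_of_nonneg (hG k).le]

lemma measurable_mittagLeffler {α β : ℝ} (hα : 0 < α) (hβ : 0 < β) :
    Measurable (mittagLeffler α β) := by
  refine measurable_of_tendsto_metrizable (f := fun n z => ∑ k ∈ Finset.range n,
    z ^ k / ((Real.Gamma (α * k + β) : ℝ) : ℂ)) (fun n => by fun_prop) ?_
  exact tendsto_pi_nhds.2 fun z => (summable_mittagLeffler hα hβ z).hasSum.tendsto_sum_nat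

/-- Hankel's integral representation of the Mittag-Leffler function, in a sector. -/
lemma mittagLeffler_eq_hankelIntegral {α β φ θ v B : ℝ} (hα : 0 < α) (hβ : 0 < β)
    (h₁ : Real.pi / 2 < φ) (h₂ : φ < Real.pi) (hθ : α * φ < θ) (hθπ : θ ≤ Real.pi) (hv : 0 ≤ v)
    (hB : θ ≤ |B|) (hBπ : |B| ≤ Real.pi) :
    mittagLeffler α β (v * cexp (B * I)) = (2 * Real.pi * I)⁻¹ *
      hankelIntegral φ 0 fun w =>
        hankelKernel (1 - β + α) w / (cexp (α * w) - v * cexp (B * I)) := by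
  have hpi := Real.pi_pos
  have hφ : Real.cos φ < 0 := Real.cos_neg_of_pi_div_two_lt_of_lt h₁ (by linarith)
  have hφ' : Real.cos (-φ) < 0 := by rwa [Real.cos_neg]
  have hφ0 : 0 ≤ φ := by linarith
  set z : ℂ := v * cexp (B * I) with hz
  obtain ⟨b, hb0, hb⟩ := exists_nonneg_norm_lt_exp hα z
  rw [mittagLeffler, tendsto_nhds_unique (summable_mittagLeffler hα hβ z).hasSum.tendsto_sum_nat
    (tendsto_sum_range_hankelIntegral h₁ h₂ hα hβ hb)]
  congr 1
  symm
  set κ := √((1 - Real.cos (θ - α * φ)) / 2) with hκ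
  have hκ0 : 0 < κ := by
    refine Real.sqrt_pos.2 (div_pos (sub_pos.2 ?_) two_pos)
    have : 0 ≤ α * φ := by positivity
    simpa using Real.cos_lt_cos_of_nonneg_of_le_pi le_rfl (by linarith) (sub_pos.2 hθ)
  have low (w : ℂ) (hw : 0 ≤ w.re) (hw' : |w.im| ≤ φ) :
      κ * (1 + v) ≤ ‖cexp (α * w) - z‖ :=
    norm_exp_sub_polar_ge hα hφ0 hθ.le hθπ hv hB hBπ hw hw'
  have ne (w : ℂ) (hw : 0 ≤ w.re) (hw' : |w.im| ≤ φ) : cexp (α * w) - z ≠ 0 :=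
    norm_pos_iff.1 ((by positivity : 0 < κ * (1 + v)).trans_le (low w hw hw'))
  have int (y : ℝ) (hy : |y| ≤ φ) (hc : Real.cos y < 0) : IntegrableOn (fun x : ℝ =>
      hankelKernel (1 - β + α) (x + y * I) / (cexp (α * (x + y * I)) - z)) (Ioi 0) := by
    refine ((integrableOn_hankelKernel_Ioi hc (1 - β + α) 0).norm.const_mul
      (κ * (1 + v))⁻¹).mono' ?_ ?_
    · refine ContinuousOn.aestronglyMeasurable (fun x hx => ContinuousAt.continuousWithinAt
        (ContinuousAt.div ?_ (by fun_prop) ?_)) measurableSet_Ioi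
      · exact (continuous_hankelKernel_horizontal _ y).continuousAt
      · exact ne _ (by simpa using (mem_Ioi.1 hx).le) (by simpa using hy)
    · filter_upwards [ae_restrict_mem measurableSet_Ioi] with x hx
      rw [norm_div, div_eq_inv_mul]
      refine mul_le_mul_of_nonneg_right (inv_anti₀ (by positivity) ?_) (norm_nonneg _)
      exact low _ (by simpa using (mem_Ioi.1 hx).le) (by simpa using hy)
  -- By `ne` there is no pole in the rectangle, so the left end moves from b, where the series
  -- converges on the contour, to 0, which does not depend on z.
  refine hankelIntegral_eq_of_le hb0 (fun w hw => ?_) (int φ (abs_of_nonneg hφ0).le hφ)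
    (int (-φ) (by rw [abs_neg, abs_of_nonneg hφ0]) hφ')
  rw [mem_reProdIm, uIcc_of_le hb0, uIcc_of_le (by linarith)] at hw
  refine DifferentiableAt.differentiableWithinAt (DifferentiableAt.div
    (differentiable_hankelKernel _ w) (by fun_prop) ?_)
  exact ne w hw.1.1 (abs_le.2 hw.2)

/-! ### Decay in a sector and on the imaginary axis -/

/-- Algebraic decay of the Mittag-Leffler function in a sector, uniformly in `β ≥ α`. -/
theorem exists_norm_mittagLeffler_le {α θ : ℝ} (hα : 0 < α)
    (hθ : α * (Real.pi / 2) < θ) (hθπ : θ ≤ Real.pi) :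
    ∃ c : ℝ, 0 < c ∧ ∀ β v B : ℝ, α ≤ β → 0 ≤ v → θ ≤ |B| → |B| ≤ Real.pi →
      ‖mittagLeffler α β (v * cexp (B * I))‖ ≤ c / (1 + v) := by
  have hpi := Real.pi_pos
  -- φ > π/2 makes the kernel decay, φ < θ/α keeps exp(αw) away from the sector; the hypothesis on θ
  -- leaves room for both.
  obtain ⟨φ, h₁, h₂⟩ : ∃ φ, Real.pi / 2 < φ ∧ φ < min Real.pi (θ / α) :=
    exists_between (lt_min (by linarith) (by rwa [lt_div_iff₀ hα, mul_comm]))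
  obtain ⟨h₂, h₃⟩ := lt_min_iff.1 h₂
  rw [lt_div_iff₀ hα, mul_comm] at h₃
  have hφ : Real.cos φ < 0 := Real.cos_neg_of_pi_div_two_lt_of_lt h₁ (by linarith)
  have hφ0 : 0 ≤ φ := by linarith
  set κ := √((1 - Real.cos (θ - α * φ)) / 2) with hκ
  have hκ0 : 0 < κ := by
    refine Real.sqrt_pos.2 (div_pos (sub_pos.2 ?_) two_pos)
    have : 0 ≤ α * φ := by positivity
    simpa using Real.cos_lt_cos_of_nonneg_of_le_pi le_rfl (by linarith) (sub_pos.2 h₃)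
  set M := (∫ y in -φ..φ, ‖hankelKernel 1 ((0 : ℝ) + y * I)‖) +
      ((∫ x in Ioi (0 : ℝ), ‖hankelKernel 1 (x + φ * I)‖) +
        ∫ x in Ioi (0 : ℝ), ‖hankelKernel 1 (x + (-φ : ℝ) * I)‖) with hM
  have hM0 : 0 ≤ M := add_nonneg
    (intervalIntegral.integral_nonneg (by linarith) fun _ _ => norm_nonneg _)
    (add_nonneg (integral_nonneg fun _ => norm_nonneg _) (integral_nonneg fun _ => norm_nonneg _))
  -- M is only known to be nonnegative; M + 1 makes the constant positive.
  refine ⟨(2 * Real.pi)⁻¹ * κ⁻¹ * (M + 1), by positivity, fun β v B hβ hv hB hBπ => ?_⟩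
  rw [mittagLeffler_eq_hankelIntegral hα (hα.trans_le hβ) h₁ h₂ h₃ hθπ hv hB hBπ, norm_mul]
  have hn : ‖(2 * Real.pi * I : ℂ)⁻¹‖ = (2 * Real.pi)⁻¹ := by
    simp [abs_of_pos hpi]
  have hb := norm_hankelIntegral_le (C := (κ * (1 + v))⁻¹) (q := 1) (a := 0) hφ hφ0 (g := fun w =>
    hankelKernel (1 - β + α) w / (cexp (α * w) - v * cexp (B * I))) (fun w hw hw' => by
      rw [norm_div, div_eq_inv_mul]
      exact mul_le_mul (inv_anti₀ (by positivity)
        (norm_exp_sub_polar_ge hα hφ0 h₃.le hθπ hv hB hBπ hw hw'))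
        (norm_hankelKernel_le_of_le (by linarith) hw) (norm_nonneg _) (by positivity))
  rw [hn]
  calc _ ≤ (2 * Real.pi)⁻¹ * ((κ * (1 + v))⁻¹ * M) :=
        mul_le_mul_of_nonneg_left hb (by positivity)
    _ = (2 * Real.pi)⁻¹ * κ⁻¹ * M / (1 + v) := by rw [mul_inv (a := κ)]; ring
    _ ≤ _ := by gcongr; linarith

/-- On the imaginary axis the argument `-a z ^ s` lies on a ray of angle `π - s π / 2`. -/
lemma exists_polar_neg_mul_cpow (a : ℝ) {s : ℝ} (hs : 0 < s) (hs1 : s ≤ 1) {z : ℂ}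
    (hz : z.re = 0) :
    ∃ B : ℝ, Real.pi - s * (Real.pi / 2) ≤ |B| ∧ |B| ≤ Real.pi ∧
      -(a : ℂ) * z ^ (s : ℂ) = (a * ‖z‖ ^ s : ℝ) * cexp (B * I) := by
  have hpi := Real.pi_pos
  have hsp : 0 < s * (Real.pi / 2) := by positivity
  have hsp' : s * (Real.pi / 2) ≤ Real.pi := by nlinarith
  rcases eq_or_ne z 0 with rfl | hz0
  · refine ⟨Real.pi, by rw [abs_of_pos hpi]; linarith, (abs_of_pos hpi).le, ?_⟩
    rw [Complex.zero_cpow (by exact_mod_cast hs.ne'), norm_zero, Real.zero_rpow hs.ne']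
    simp
  have hpow : z ^ (s : ℂ) = (‖z‖ ^ s : ℝ) * cexp ((s * arg z : ℝ) * I) := by
    rw [Complex.ofReal_cpow (norm_nonneg z), Complex.cpow_def_of_ne_zero hz0,
      Complex.cpow_def_of_ne_zero (by simpa using hz0), ← Complex.exp_add, Complex.log,
      ← Complex.ofReal_log (norm_nonneg z)]
    push_cast; ring_nf
  have hzI : z = z.im * I := by apply Complex.ext <;> simp [hz]
  have him : z.im ≠ 0 := fun h => hz0 (by rw [hzI, h]; simp)
  -- The factor -1 is taken as e^{iπ} on the lower half-axis and e^{-iπ} on the upper one, so that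
  -- |B| ≤ π.
  rcases him.lt_or_gt with h | h
  · have harg : arg z = -(Real.pi / 2) := by
      rw [hzI, show (z.im : ℂ) * I = (-z.im : ℝ) * -I by push_cast; ring,
        arg_real_mul _ (by linarith), arg_neg_I]
    have hB : 0 ≤ Real.pi - s * (Real.pi / 2) := by linarith
    refine ⟨Real.pi - s * (Real.pi / 2), (abs_of_nonneg hB).ge, by
      rw [abs_of_nonneg hB]; linarith, ?_⟩
    rw [hpow, harg]
    have : ((Real.pi - s * (Real.pi / 2) : ℝ) : ℂ) * I =
        Real.pi * I + (s * -(Real.pi / 2) : ℝ) * I := by push_cast; ring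
    rw [this, Complex.exp_add, Complex.exp_pi_mul_I, ofReal_mul a]
    ring
  · have harg : arg z = Real.pi / 2 := by
      rw [hzI, arg_real_mul _ h, arg_I]
    have hB : 0 ≤ Real.pi - s * (Real.pi / 2) := by linarith
    refine ⟨-(Real.pi - s * (Real.pi / 2)), by rw [abs_neg, abs_of_nonneg hB], by
      rw [abs_neg, abs_of_nonneg hB]; linarith, ?_⟩
    rw [hpow, harg]
    have : ((-(Real.pi - s * (Real.pi / 2)) : ℝ) : ℂ) * I =
        -(Real.pi * I) + (s * (Real.pi / 2) : ℝ) * I := by push_cast; ring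
    rw [this, Complex.exp_add, Complex.exp_neg, Complex.exp_pi_mul_I, ofReal_mul a]
    ring

theorem exists_isDecayConst {α σ : ℝ} (hα : 0 < α) (hσ : 0 < σ) (hσ1 : σ ≤ 1)
    (h : σ + α < 2) :
    ∃ c : ℝ, ∀ β t s : ℝ, α ≤ β → 0 < t → 0 < s → s ≤ σ → IsDecayConst α β t s c := by
  have hpi := Real.pi_pos
  -- This θ is the smallest angle that occurs for s ≤ σ, and απ/2 < θ is σ + α < 2.
  obtain ⟨c, hc, hE⟩ := exists_norm_mittagLeffler_le (θ := Real.pi - σ * (Real.pi / 2)) hα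
    (by nlinarith) (by nlinarith)
  refine ⟨c, fun β t s hβ ht hs hsσ => ⟨hc, fun z hz => ?_⟩⟩
  obtain ⟨B, hB, hBπ, e⟩ := exists_polar_neg_mul_cpow (t ^ α) hs (hsσ.trans hσ1) hz
  rw [fracML, e]
  exact hE β _ B hβ (by positivity) (le_trans (by nlinarith) hB) hBπ

/-! ### The imaginary-axis constant -/

/-- Dividing through by a r^s turns the integrand into a logarithmic derivative of 1 + a⁻¹ r^(-s);
this primitive vanishes at infinity. -/
lemma hasDerivAt_log_one_add_rpow_neg {a s r : ℝ} (ha : 0 < a) (hs : 0 < s) (hr : 0 < r) :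
    HasDerivAt (fun r : ℝ => -(s⁻¹ * Real.log (1 + a⁻¹ * r ^ (-s))))
      (r * (1 + a * r ^ s))⁻¹ r := by
  have hp : 0 < r ^ s := Real.rpow_pos_of_pos hr s
  have h := ((((Real.hasDerivAt_rpow_const (p := -s) (Or.inl hr.ne')).const_mul a⁻¹).const_add
    1).log (by positivity)).const_mul s⁻¹ |>.neg
  refine h.congr_deriv ?_
  rw [Real.rpow_sub_one hr.ne', Real.rpow_neg hr.le]
  field_simp
  ring

lemma tendsto_log_one_add_rpow_neg (a : ℝ) {s : ℝ} (hs : 0 < s) :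
    Tendsto (fun r : ℝ => -(s⁻¹ * Real.log (1 + a⁻¹ * r ^ (-s)))) atTop (𝓝 0) := by
  have h : Tendsto (fun r : ℝ => 1 + a⁻¹ * r ^ (-s)) atTop (𝓝 1) := by
    simpa using ((tendsto_rpow_neg_atTop hs).const_mul a⁻¹).const_add 1
  simpa using ((h.log one_ne_zero).const_mul s⁻¹).neg

lemma integrableOn_inv_mul_one_add_rpow {a s : ℝ} (ha : 0 < a) (hs : 0 < s) :
    IntegrableOn (fun r : ℝ => (r * (1 + a * r ^ s))⁻¹) (Ioi 1) :=
  integrableOn_Ioi_deriv_of_nonneg'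
    (fun _ hr => hasDerivAt_log_one_add_rpow_neg ha hs (one_pos.trans_le hr))
    (fun r hr => by have : 0 < r := one_pos.trans hr; positivity)
    (tendsto_log_one_add_rpow_neg a hs)

lemma integral_inv_mul_one_add_rpow {a s : ℝ} (ha : 0 < a) (hs : 0 < s) :
    ∫ r in Ioi (1 : ℝ), (r * (1 + a * r ^ s))⁻¹ = s⁻¹ * Real.log (1 + a⁻¹) := by
  rw [integral_Ioi_of_hasDerivAt_of_nonneg'
    (fun _ hr => hasDerivAt_log_one_add_rpow_neg ha hs (one_pos.trans_le hr))
    (fun r hr => by have : 0 < r := one_pos.trans hr; positivity)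
    (tendsto_log_one_add_rpow_neg a hs)]
  simp

/-- A function of `|y|` is integrable if its restriction to the positive half-line is. -/
lemma integrable_comp_abs_of_integrableOn_Ioi {k : ℝ → ℝ} (h : IntegrableOn k (Ioi 0)) :
    Integrable fun y : ℝ => k |y| := by
  have hp : IntegrableOn (fun y : ℝ => k |y|) (Ioi 0) :=
    h.congr_fun (fun y hy => by simp [abs_of_pos (mem_Ioi.1 hy)]) measurableSet_Ioi
  have hn : IntegrableOn (fun y : ℝ => k |y|) (Iio 0) := by
    have h0 : IntegrableOn (fun y : ℝ => k |y|) (Ioi (-0)) := by rwa [neg_zero]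
    simpa only [abs_neg] using h0.comp_neg_Iio
  rw [← integrableOn_univ, ← Iic_union_Ioi (a := (0 : ℝ))]
  exact ((integrableOn_Iic_iff_integrableOn_Iio (by finiteness)).2 hn).union hp

theorem integrable_and_imagAxisConst_le {α β t s l c : ℝ} (hα : 0 < α) (hβ : 0 < β) (ht : 0 < t)
    (hs : 0 < s) (hl : 0 < l) (hc : IsDecayConst α β t s c) :
    Integrable (imagAxisIntegrand (fracML α β t s) l) ∧
      imagAxisConst (fracML α β t s) l ≤ 2 * c * (l⁻¹ + s⁻¹ * Real.log (1 + t ^ (-α))) := by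
  obtain ⟨hc0, hdec⟩ := hc
  have ha : 0 < t ^ α := Real.rpow_pos_of_pos ht α
  -- Majorant in r = |y|: for r ≤ 1 the decay factor is bounded by c and the denominator below by l;
  -- for r > 1 the decay is kept and the denominator bounded below by r.
  set k : ℝ → ℝ := fun r => if r ≤ 1 then c * l⁻¹ else c * (r * (1 + t ^ α * r ^ s))⁻¹ with hk
  have k1 : EqOn k (fun _ => c * l⁻¹) (Ioc 0 1) := fun r hr => if_pos hr.2
  have k2 : EqOn k (fun r => c * (r * (1 + t ^ α * r ^ s))⁻¹) (Ioi 1) :=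
    fun r hr => if_neg (not_le.2 hr)
  have i1 : IntegrableOn k (Ioc 0 1) :=
    (integrableOn_const (by simp)).congr_fun k1.symm measurableSet_Ioc
  have i2 : IntegrableOn k (Ioi 1) :=
    IntegrableOn.congr_fun ((integrableOn_inv_mul_one_add_rpow ha hs).const_mul c) k2.symm
      measurableSet_Ioi
  have ik : IntegrableOn k (Ioi 0) := by
    rw [← Ioc_union_Ioi_eq_Ioi zero_le_one]; exact i1.union i2
  have ik' := integrable_comp_abs_of_integrableOn_Ioi ik
  have bound (y : ℝ) : imagAxisIntegrand (fracML α β t s) l y ≤ k |y| := by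
    have hf := hdec (y * I) (by simp)
    have hy : ‖(y * I : ℂ)‖ = |y| := by simp
    rw [hy] at hf
    have hden : 0 ≤ t ^ α * |y| ^ s := by positivity
    rw [imagAxisIntegrand, norm_div]
    simp only [hk]
    split_ifs with h1
    · have hre : l ≤ ‖(y * I + l : ℂ)‖ := by
        simpa [abs_of_pos hl] using abs_re_le_norm (y * I + l : ℂ)
      rw [div_eq_mul_inv]
      refine mul_le_mul (hf.trans (div_le_self hc0.le (by linarith))) (inv_anti₀ hl hre)
        (by positivity) hc0.le
    · have hy0 : 0 < |y| := by linarith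
      have him : |y| ≤ ‖(y * I + l : ℂ)‖ := by
        simpa using abs_im_le_norm (y * I + l : ℂ)
      rw [mul_inv_rev, ← mul_assoc, ← div_eq_mul_inv, div_eq_mul_inv _ ‖_‖]
      exact mul_le_mul hf (inv_anti₀ hy0 him) (by positivity) (by positivity)
  have meas : Measurable (imagAxisIntegrand (fracML α β t s) l) := by
    have hE := measurable_mittagLeffler hα hβ
    unfold imagAxisIntegrand fracML
    refine Measurable.norm (Measurable.div (hE.comp ?_) (by fun_prop))
    exact (measurable_const.mul (Measurable.pow_const (by fun_prop) _))
  have int : Integrable (imagAxisIntegrand (fracML α β t s) l) :=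
    ik'.mono' meas.aestronglyMeasurable (Eventually.of_forall fun y => by
      exact (Real.norm_of_nonneg (norm_nonneg _)).trans_le (bound y))
  refine ⟨int, (integral_mono int ik' bound).trans_eq ?_⟩
  -- The two half-lines give the factor 2; with a = t^α the tail is s⁻¹ log(1 + t^(-α)).
  rw [integral_comp_abs (f := k), ← Ioc_union_Ioi_eq_Ioi zero_le_one,
    setIntegral_union (Ioc_disjoint_Ioi le_rfl) measurableSet_Ioi i1 i2,
    setIntegral_congr_fun measurableSet_Ioc k1, setIntegral_congr_fun measurableSet_Ioi k2,
    integral_const_mul c fun r : ℝ => (r * (1 + t ^ α * r ^ s))⁻¹,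
    integral_inv_mul_one_add_rpow ha hs, Real.rpow_neg ht.le]
  simp
  ring

theorem lemma4p2 (α : ℝ) (hα : 0 < α) (hα1 : α ≤ 1) :
    -- existence of the decay constant, independent of `β`, `t` and of `s ≤ σ`
    -- (for `α < 1` one may take `σ = 1`, so that it depends on `α` only)
    (∀ σ : ℝ, 0 < σ → σ ≤ 1 → σ + α < 2 →
      ∃ c : ℝ, ∀ β t s : ℝ, α ≤ β → 0 < t → 0 < s → s ≤ σ → IsDecayConst α β t s c) ∧
    -- the bound for `c_f`, for every admissible decay constant
    (∀ β t s l c : ℝ, α ≤ β → 0 < t → 0 < s → s ≤ 1 → s + α < 2 → 0 < l →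
      IsDecayConst α β t s c →
        Integrable (imagAxisIntegrand (fracML α β t s) l) ∧
        imagAxisConst (fracML α β t s) l
          ≤ 2 * c * (l⁻¹ + s⁻¹ * Real.log (1 + t ^ (-α)))) :=
  ⟨fun _ hσ hσ1 h => exists_isDecayConst hα hσ hσ1 h,
    fun _ _ _ _ _ hβ ht hs _ _ hl hc =>
      integrable_and_imagAxisConst_le hα (hα.trans_le hβ) ht hs hl hc⟩
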